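/- Let $S$ be a semilattice, that is, a commutative semigroup (with or without an identity element) in which $s^2=s$ for every $s\in S$, and let $\ell^1(S)$ be its complex $\ell^1$-convolution algebra, with product $(f*g)(s)=\sum_{xy=s}f(x)g(y)$. Let $M$ be a Banach $\ell^1(S)$-bimodule that is symmetric, i.e. $a\cdot x=x\cdot a$ for all $a\in\ell^1(S)$ and $x\in M$. Then the continuous Hochschild cohomology groups satisfy \[ H^n(\ell^1(S),M)=0\qquad\text{for all } n\ge 1. \] Here, for a Banach algebra $A$ and a Banach $A$-bimodule $M$, $C^n(A,M)$ is the space of bounded $n$-linear maps $A^n\to M$, the coboundary $\delta_n:C^n(A,M)\to C^{n+1}(A,M)$ is \[ (\delta_nF)(a_1,\dots,a_{n+1})=a_1\cdot F(a_2,\dots,a_{n+1})+\sum_{j=1}^n(-1)^jF(a_1,\dots,a_ja_{j+1},\dots,a_{n+1})+(-1)^{n+1}F(a_1,\dots,a_n)\cdot a_{n+1}, \] and $H^n(A,M)=\ker\delta_n/\operatorname{im}\delta_{n-1}$ for $n\geq 1$. -/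

import Mathlib

noncomputable section

/-- The Banach space `ℓ¹(S)` of absolutely summable complex functions on `S`. -/
abbrev EllOne (S : Type*) := lp (fun _ : S => ℂ) 1

namespace EllOne

variable {S : Type*}

theorem summable_norm (f : EllOne S) : Summable fun s => ‖f s‖ := by
  simpa using (lp.memℓp f).summable (by simp)

theorem norm_eq_tsum (f : EllOne S) : ‖f‖ = ∑' s, ‖f s‖ := by
  simpa using lp.norm_eq_tsum_rpow (p := 1) (by simp) f

theorem summable_norm_prod (f g : EllOne S) :
    Summable fun p : S × S => ‖f p.1 * g p.2‖ :=
  (summable_norm f).mul_norm (summable_norm g)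

open Classical in
theorem apply_eq_tsum (f : EllOne S) (s : S) :
    f s = ∑' t, (if t = s then (1 : ℂ) else 0) * f t := by
  rw [tsum_eq_single s]
  · simp
  · intro t ht
    simp [ht]

variable [Semigroup S]

/-- Convolution: `(f * g)(s) = ∑_{xy = s} f(x) g(y)`. -/
def convFun (f g : EllOne S) (s : S) : ℂ :=
  ∑' p : {p : S × S // p.1 * p.2 = s}, f p.1.1 * g p.1.2

theorem summable_norm_sigma (f g : EllOne S) :
    Summable fun q : Σ s : S, {p : S × S // p.1 * p.2 = s} => ‖f q.2.1.1 * g q.2.1.2‖ :=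
  (Equiv.sigmaFiberEquiv fun p : S × S => p.1 * p.2).summable_iff.2 (summable_norm_prod f g)

theorem norm_convFun_le (f g : EllOne S) (s : S) :
    ‖convFun f g s‖ ≤ ∑' p : {p : S × S // p.1 * p.2 = s}, ‖f p.1.1 * g p.1.2‖ :=
  norm_tsum_le_tsum_norm ((summable_norm_sigma f g).sigma_factor s)

theorem summable_norm_convFun (f g : EllOne S) : Summable fun s => ‖convFun f g s‖ :=
  Summable.of_nonneg_of_le (fun _ => norm_nonneg _) (norm_convFun_le f g)
    (summable_norm_sigma f g).sigma

theorem tsum_norm_convFun_le (f g : EllOne S) :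
    ∑' s, ‖convFun f g s‖ ≤ ‖f‖ * ‖g‖ := by
  calc ∑' s, ‖convFun f g s‖
      ≤ ∑' s, ∑' p : {p : S × S // p.1 * p.2 = s}, ‖f p.1.1 * g p.1.2‖ :=
        (summable_norm_convFun f g).tsum_le_tsum (norm_convFun_le f g)
          (summable_norm_sigma f g).sigma
    _ = ∑' q : Σ s : S, {p : S × S // p.1 * p.2 = s}, ‖f q.2.1.1 * g q.2.1.2‖ :=
        ((summable_norm_sigma f g).tsum_sigma).symm
    _ = ∑' p : S × S, ‖f p.1 * g p.2‖ :=
        (Equiv.sigmaFiberEquiv fun p : S × S => p.1 * p.2).tsum_eq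
          fun p : S × S => ‖f p.1 * g p.2‖
    _ = ‖f‖ * ‖g‖ := by
        rw [norm_eq_tsum, norm_eq_tsum,
          (summable_norm f).tsum_mul_tsum (summable_norm g)]
        · simp only [norm_mul]
        · simpa only [norm_mul] using summable_norm_prod f g

instance : Mul (EllOne S) where
  mul f g := ⟨convFun f g, by
    refine memℓp_gen ?_
    simpa using summable_norm_convFun f g⟩

theorem mul_apply (f g : EllOne S) (s : S) :
    (f * g) s = ∑' p : {p : S × S // p.1 * p.2 = s}, f p.1.1 * g p.1.2 := rfl

theorem summable_fiber (f g : EllOne S) (s : S) :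
    Summable fun p : {p : S × S // p.1 * p.2 = s} => f p.1.1 * g p.1.2 :=
  ((summable_norm_sigma f g).sigma_factor s).of_norm

theorem summable_bdd {ι : Type*} {u : ι → ℂ} (hu : Summable fun i => ‖u i‖) {φ : ι → ℂ}
    (hφ : ∀ i, ‖φ i‖ ≤ 1) : Summable fun i => φ i * u i := by
  refine Summable.of_norm_bounded hu fun i => ?_
  rw [norm_mul]
  exact mul_le_of_le_one_left (norm_nonneg _) (hφ i)

/-- Pairing a convolution product with a bounded function. -/
theorem tsum_mul_apply (f g : EllOne S) {φ : S → ℂ} (hφ : ∀ s, ‖φ s‖ ≤ 1) :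
    ∑' s, φ s * (f * g) s = ∑' x, ∑' y, φ (x * y) * (f x * g y) := by
  have h1 : Summable fun p : S × S => φ (p.1 * p.2) * (f p.1 * g p.2) :=
    summable_bdd (summable_norm_prod f g) fun p => hφ _
  rw [← h1.tsum_prod, ← (Equiv.sigmaFiberEquiv fun p : S × S => p.1 * p.2).tsum_eq,
    Summable.tsum_sigma]
  · refine tsum_congr fun s => ?_
    rw [mul_apply, ← tsum_mul_left]
    refine tsum_congr fun p => ?_
    simp [Equiv.sigmaFiberEquiv, p.2]
  · exact (Equiv.sigmaFiberEquiv fun p : S × S => p.1 * p.2).summable_iff.2 h1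

theorem mul_assoc' (f g h : EllOne S) : f * g * h = f * (g * h) := by
  classical
  ext s
  set δ : S → ℂ := fun t => if t = s then (1 : ℂ) else 0 with hδ
  have hb : ∀ t, ‖δ t‖ ≤ 1 := fun t => by
    simp only [hδ]; split_ifs <;> simp
  have hprod : Summable fun p : S × S => δ (p.1 * p.2) * ((f * g) p.1 * h p.2) :=
    summable_bdd (summable_norm_prod (f * g) h) fun p => hb _
  rw [apply_eq_tsum (f * g * h) s, apply_eq_tsum (f * (g * h)) s]
  change ∑' t, δ t * (f * g * h) t = ∑' t, δ t * (f * (g * h)) t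
  rw [tsum_mul_apply _ _ hb, tsum_mul_apply _ _ hb]
  have e1 : ∀ t, ∑' z, δ (t * z) * ((f * g) t * h z) = (∑' z, δ (t * z) * h z) * (f * g) t := by
    intro t
    rw [← tsum_mul_right]
    exact tsum_congr fun z => by ring
  have e2 : ∀ x, ∑' t, δ (x * t) * (f x * (g * h) t)
      = f x * ∑' y, ∑' z, δ (x * (y * z)) * (g y * h z) := by
    intro x
    rw [← tsum_mul_apply g h (φ := fun t => δ (x * t)) (fun t => hb _), ← tsum_mul_left]
    exact tsum_congr fun z => by ring
  simp_rw [e1, e2]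
  -- scale so that the pairing function is bounded by `1`
  set ψ : S → ℂ := fun t => ∑' z, δ (t * z) * h z with hψ
  have hψb : ∀ t, ‖ψ t‖ ≤ ‖h‖ := by
    intro t
    rw [norm_eq_tsum]
    refine tsum_of_norm_bounded (summable_norm h).hasSum fun z => ?_
    rw [norm_mul]
    exact mul_le_of_le_one_left (norm_nonneg _) (hb _)
  have key : ∑' t, ψ t * (f * g) t = ∑' x, ∑' y, ψ (x * y) * (f x * g y) := by
    have hpos : (0 : ℝ) < ‖h‖ + 1 := by positivity
    have hc : ((‖h‖ + 1 : ℝ) : ℂ) ≠ 0 := by exact_mod_cast hpos.ne'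
    have hs := tsum_mul_apply f g (φ := fun t => ((‖h‖ + 1 : ℝ) : ℂ)⁻¹ * ψ t) (by
      intro t
      rw [norm_mul, norm_inv, Complex.norm_real, Real.norm_of_nonneg hpos.le]
      rw [inv_mul_le_iff₀ hpos]
      linarith [hψb t])
    simp_rw [mul_assoc, tsum_mul_left] at hs
    exact mul_left_cancel₀ (inv_ne_zero hc) hs
  rw [key]
  refine tsum_congr fun x => ?_
  rw [← tsum_mul_left]
  refine tsum_congr fun y => ?_
  simp only [hψ]
  rw [← tsum_mul_left, ← tsum_mul_right]
  refine tsum_congr fun z => ?_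
  rw [mul_assoc x y z]
  ring

/-- `ℓ¹(S)` with convolution and the `ℓ¹`-norm is a (possibly non-unital) Banach algebra. -/
instance : NonUnitalNormedRing (EllOne S) :=
  { lp.normedAddCommGroup with
    mul := (· * ·)
    left_distrib := fun f g h => by
      ext s
      simp only [lp.coeFn_add, Pi.add_apply, mul_apply, mul_add]
      exact (summable_fiber f g s).tsum_add (summable_fiber f h s)
    right_distrib := fun f g h => by
      ext s
      simp only [lp.coeFn_add, Pi.add_apply, mul_apply, add_mul]
      exact (summable_fiber f h s).tsum_add (summable_fiber g h s)
    zero_mul := fun f => by ext s; simp [mul_apply]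
    mul_zero := fun f => by ext s; simp [mul_apply]
    mul_assoc := mul_assoc'
    norm_mul_le := fun f g => by
      rw [norm_eq_tsum (f * g)]
      exact tsum_norm_convFun_le f g }

instance : IsScalarTower ℂ (EllOne S) (EllOne S) where
  smul_assoc c f g := by
    ext s
    simp only [smul_eq_mul, lp.coeFn_smul, Pi.smul_apply, mul_apply, mul_assoc, tsum_mul_left]

instance : SMulCommClass ℂ (EllOne S) (EllOne S) where
  smul_comm c f g := by
    ext s
    simp only [smul_eq_mul, lp.coeFn_smul, Pi.smul_apply, mul_apply, mul_left_comm _ c,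
      tsum_mul_left]

end EllOne

section Hochschild

variable {A M : Type*} [NonUnitalNormedRing A] [NormedSpace ℂ A]
  [NormedAddCommGroup M] [NormedSpace ℂ M]

/-- A Banach `A`-bimodule structure on the Banach space `M`: commuting bounded left and right
actions of `A`. Here `left a x` is `a · x` and `right a x` is `x · a`. No unit is assumed to act
as the identity. -/
structure BanachBimodule (A M : Type*) [NonUnitalNormedRing A] [NormedSpace ℂ A]
    [NormedAddCommGroup M] [NormedSpace ℂ M] where
  left : A →L[ℂ] M →L[ℂ] M
  right : A →L[ℂ] M →L[ℂ] M
  left_mul : ∀ (a b : A) (x : M), left (a * b) x = left a (left b x)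
  right_mul : ∀ (a b : A) (x : M), right (a * b) x = right b (right a x)
  left_right : ∀ (a b : A) (x : M), left a (right b x) = right b (left a x)

/-- The bimodule is symmetric: `a · x = x · a`. -/
def BanachBimodule.IsSymmetric (X : BanachBimodule A M) : Prop :=
  ∀ (a : A) (x : M), X.left a x = X.right a x

/-- Bounded `n`-linear maps `Aⁿ → M`. -/
abbrev HochschildCochain (A M : Type*) [NonUnitalNormedRing A] [NormedSpace ℂ A]
    [NormedAddCommGroup M] [NormedSpace ℂ M] (n : ℕ) :=
  ContinuousMultilinearMap ℂ (fun _ : Fin n => A) M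

namespace Hochschild

/-- The value `(δF)(a₁, …, aₙ₊₁)` of the Hochschild coboundary. The argument of the middle terms
is `(a₁, …, aⱼaⱼ₊₁, …, aₙ₊₁)`; the index `j` of the code starts at `0`, that of the formula
at `1`. -/
def coboundaryFun (X : BanachBimodule A M) {n : ℕ} (F : HochschildCochain A M n)
    (a : Fin (n + 1) → A) : M :=
  X.left (a 0) (F (Fin.tail a))
    + ∑ j : Fin n, (-1 : ℂ) ^ ((j : ℕ) + 1) • F (Fin.contractNth j.castSucc (· * ·) a)
    + (-1 : ℂ) ^ (n + 1) • X.right (a (Fin.last n)) (F (Fin.init a))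

theorem exists_contractNth_update [IsScalarTower ℂ A A] [SMulCommClass ℂ A A] {n : ℕ}
    (j : Fin n) (a : Fin (n + 1) → A) (i : Fin (n + 1)) :
    ∃ (k : Fin n) (φ : A →ₗ[ℂ] A), ∀ x,
      Fin.contractNth j.castSucc (· * ·) (Function.update a i x)
        = Function.update (Fin.contractNth j.castSucc (· * ·) a) k (φ x) := by
  rcases lt_trichotomy (i : ℕ) j with h | h | h
  · refine ⟨⟨i, by omega⟩, LinearMap.id, fun x => ?_⟩
    ext k
    simp only [Fin.contractNth, Function.update_apply, Fin.ext_iff, Fin.val_castSucc, Fin.val_succ,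
      LinearMap.id_apply]
    grind
  · refine ⟨j, LinearMap.mulRight ℂ (a j.succ), fun x => ?_⟩
    ext k
    simp only [Fin.contractNth, Function.update_apply, Fin.ext_iff, Fin.val_castSucc, Fin.val_succ,
      LinearMap.mulRight_apply]
    grind
  · rcases Nat.lt_or_ge ((j : ℕ) + 1) i with h' | h'
    · refine ⟨⟨i - 1, by omega⟩, LinearMap.id, fun x => ?_⟩
      ext k
      simp only [Fin.contractNth, Function.update_apply, Fin.ext_iff, Fin.val_castSucc,
        Fin.val_succ, LinearMap.id_apply]
      grind
    · refine ⟨j, LinearMap.mulLeft ℂ (a j.castSucc), fun x => ?_⟩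
      ext k
      simp only [Fin.contractNth, Function.update_apply, Fin.ext_iff, Fin.val_castSucc,
        Fin.val_succ, LinearMap.mulLeft_apply]
      grind

theorem exists_left_update (X : BanachBimodule A M) {n : ℕ} (F : HochschildCochain A M n)
    (a : Fin (n + 1) → A) (i : Fin (n + 1)) :
    ∃ φ : A →ₗ[ℂ] M, ∀ x,
      X.left (Function.update a i x 0) (F (Fin.tail (Function.update a i x))) = φ x := by
  induction i using Fin.cases with
  | zero =>
    exact ⟨(X.left.flip (F (Fin.tail a))).toLinearMap, fun x => by simp⟩
  | succ k =>
    refine ⟨(X.left (a 0)).toLinearMap ∘ₗ F.toMultilinearMap.toLinearMap (Fin.tail a) k,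
      fun x => ?_⟩
    rw [Fin.tail_update_succ, Function.update_of_ne (Fin.succ_ne_zero k).symm]
    simp

theorem exists_right_update (X : BanachBimodule A M) {n : ℕ} (F : HochschildCochain A M n)
    (a : Fin (n + 1) → A) (i : Fin (n + 1)) :
    ∃ φ : A →ₗ[ℂ] M, ∀ x,
      X.right (Function.update a i x (Fin.last n)) (F (Fin.init (Function.update a i x)))
        = φ x := by
  induction i using Fin.lastCases with
  | last =>
    exact ⟨(X.right.flip (F (Fin.init a))).toLinearMap, fun x => by simp⟩
  | cast k =>
    refine ⟨(X.right (a (Fin.last n))).toLinearMap ∘ₗ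
      F.toMultilinearMap.toLinearMap (Fin.init a) k, fun x => ?_⟩
    rw [Fin.init_update_castSucc, Function.update_of_ne (Fin.castSucc_lt_last k).ne']
    simp

theorem continuous_coboundaryFun (X : BanachBimodule A M) {n : ℕ}
    (F : HochschildCochain A M n) : Continuous (coboundaryFun X F) := by
  have hc : ∀ j : Fin n, Continuous fun a : Fin (n + 1) → A =>
      Fin.contractNth j.castSucc (· * ·) a := by
    intro j
    refine continuous_pi fun k => ?_
    unfold Fin.contractNth
    split_ifs <;> fun_prop
  have hl : Continuous fun a : Fin (n + 1) → A => F (Fin.tail a) :=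
    F.cont.comp (by unfold Fin.tail; fun_prop)
  have hr : Continuous fun a : Fin (n + 1) → A => F (Fin.init a) :=
    F.cont.comp (by unfold Fin.init; fun_prop)
  refine ((?_ : Continuous _).add ?_).add ?_
  · exact (X.left.continuous.comp (continuous_apply 0)).clm_apply hl
  · exact continuous_finsetSum _ fun j _ => (F.cont.comp (hc j)).const_smul _
  · exact ((X.right.continuous.comp (continuous_apply (Fin.last n))).clm_apply hr).const_smul _

variable [IsScalarTower ℂ A A] [SMulCommClass ℂ A A]

theorem exists_coboundaryFun_update (X : BanachBimodule A M) {n : ℕ}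
    (F : HochschildCochain A M n) (a : Fin (n + 1) → A) (i : Fin (n + 1)) :
    ∃ φ : A →ₗ[ℂ] M, ∀ x, coboundaryFun X F (Function.update a i x) = φ x := by
  obtain ⟨φ, hφ⟩ := exists_left_update X F a i
  obtain ⟨ψ, hψ⟩ := exists_right_update X F a i
  choose k χ hχ using fun j : Fin n => exists_contractNth_update j a i
  refine ⟨φ + ∑ j : Fin n, (-1 : ℂ) ^ ((j : ℕ) + 1) •
    (F.toMultilinearMap.toLinearMap (Fin.contractNth j.castSucc (· * ·) a) (k j) ∘ₗ χ j)
      + (-1 : ℂ) ^ (n + 1) • ψ, fun x => ?_⟩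
  simp [coboundaryFun, hφ, hψ, hχ]

/-- The Hochschild coboundary operator `δₙ : Cⁿ(A, M) → Cⁿ⁺¹(A, M)`. -/
def coboundary (X : BanachBimodule A M) (n : ℕ) :
    HochschildCochain A M n →ₗ[ℂ] HochschildCochain A M (n + 1) where
  toFun F :=
    { MultilinearMap.mk' (coboundaryFun X F)
        (fun a i x y => by
          obtain ⟨φ, hφ⟩ := exists_coboundaryFun_update X F a i
          simp only [hφ, map_add])
        (fun a i c x => by
          obtain ⟨φ, hφ⟩ := exists_coboundaryFun_update X F a i
          simp only [hφ, map_smul]) with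
      cont := continuous_coboundaryFun X F }
  map_add' F G := by
    ext a
    change coboundaryFun X (F + G) a = coboundaryFun X F a + coboundaryFun X G a
    simp only [coboundaryFun, add_apply, map_add, smul_add,
      Finset.sum_add_distrib]
    abel
  map_smul' c F := by
    ext a
    change coboundaryFun X (c • F) a = c • coboundaryFun X F a
    simp only [coboundaryFun, smul_apply, map_smul, smul_add,
      Finset.smul_sum, smul_comm c]

theorem coboundary_apply (X : BanachBimodule A M) (n : ℕ) (F : HochschildCochain A M n)
    (a : Fin (n + 1) → A) :
    coboundary X n F a =
      X.left (a 0) (F (Fin.tail a))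
        + ∑ j : Fin n, (-1 : ℂ) ^ ((j : ℕ) + 1) • F (Fin.contractNth j.castSucc (· * ·) a)
        + (-1 : ℂ) ^ (n + 1) • X.right (a (Fin.last n)) (F (Fin.init a)) := rfl

/-- The `n`-cocycles, `ker δₙ`. -/
def cocycles (X : BanachBimodule A M) (n : ℕ) : Submodule ℂ (HochschildCochain A M n) :=
  LinearMap.ker (coboundary X n)

/-- The `n`-coboundaries, `im δₙ₋₁` (zero for `n = 0`). -/
def coboundaries (X : BanachBimodule A M) : (n : ℕ) → Submodule ℂ (HochschildCochain A M n)
  | 0 => ⊥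
  | n + 1 => LinearMap.range (coboundary X n)

/-- The continuous Hochschild cohomology group `Hⁿ(A, M) = ker δₙ / im δₙ₋₁`. -/
abbrev Cohomology (X : BanachBimodule A M) (n : ℕ) :=
  cocycles X n ⧸ (coboundaries X n).submoduleOf (cocycles X n)

end Hochschild

end Hochschild

end

/-! Through point masses, cochains on `ℓ¹(S)` are the bounded functions `Sⁿ → M`, so it suffices to
contract the complex `delta` boundedly in positive degrees. An idempotent `s` has the diagonal `s ⊗
s + (1 - s) ⊗ (1 - s)` for the algebra spanned by `1` and `s`; the product of these over a finite
list `l` is a diagonal for the algebra generated by `1` and `l`. Averaging over it turns translation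
into action (`averageList_translate_of_mem_closure`) and contracts the complex on tuples whose first
entry lies in the subsemigroup generated by `l` (`contractFirst_delta`).

The available bound on this average grows exponentially with the length of `l`, so one contraction
cannot serve all of `S`. Instead `homotopy` uses at each tuple `s` the contraction `K_s` given by
the entries of `s`, with the recursive correction `(H F)(s) = (K_s F - δ H K_s F)(s)`. Since `H F`
on a subsemigroup `T` depends only on `F` on `T` (`homotopy_eq_zero`), the local identity `K_s δ F =
F - δ K_s F` may be inserted under `H`, and induction gives `H δ + δ H = 1` (`homotopy_delta`). All
lists in a given degree have the same length, so `H` preserves boundedness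
(`exists_norm_homotopy_le`). -/

noncomputable section

namespace SemigroupCochain

variable {S M : Type*} [NormedAddCommGroup M] [NormedSpace ℂ M]

/-! ### The cochain complex of a commutative semigroup acting on `M`. -/

section Face

variable [Mul S] {n : ℕ}

/-- The `i`-th face of a tuple: drop the first entry, multiply the `i`-th entry by its
predecessor, or drop the last entry. -/
def face (i : Fin (n + 2)) (a : Fin (n + 1) → S) (k : Fin n) : S :=
  if (k : ℕ) + 1 < i then a k.castSucc
  else if (k : ℕ) + 1 = i then a k.castSucc * a k.succ else a k.succ

/-- The element by which the coefficients are multiplied along the `i`-th face. -/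
def weight (i : Fin (n + 2)) (a : Fin (n + 1) → S) : WithOne S :=
  if (i : ℕ) = 0 then a 0 else if (i : ℕ) = n + 1 then a (Fin.last n) else 1

theorem face_zero (a : Fin (n + 1) → S) : face 0 a = Fin.tail a := by
  ext k; simp [face, Fin.tail]

theorem face_last (a : Fin (n + 1) → S) : face (Fin.last (n + 1)) a = Fin.init a := by
  ext k; simp [face, Fin.init]

theorem face_succ_castSucc (a : Fin (n + 1) → S) (j : Fin n) :
    face j.castSucc.succ a = Fin.contractNth j.castSucc (· * ·) a := by
  ext k; simp [face, Fin.contractNth]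

end Face

theorem face_face [Semigroup S] {n : ℕ} (i : Fin (n + 2)) (j : Fin (n + 3)) (h : (j : ℕ) ≤ i)
    (a : Fin (n + 2) → S) :
    face i (face j a) = face (j.castLT (by omega)) (face i.succ a) := by
  ext k
  simp only [face, Fin.val_succ, Fin.val_castSucc, Fin.val_castLT, Fin.succ_castSucc]
  have := mul_assoc (a k.castSucc.castSucc) (a k.succ.castSucc) (a k.succ.succ)
  split_ifs <;> first | rfl | omega

/-- The companion of `face_face` for the coefficients. Both outer faces act through the same `ρ`, so
the first and last entries must commute. -/
theorem weight_weight [CommSemigroup S] {n : ℕ} (i : Fin (n + 2)) (j : Fin (n + 3))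
    (h : (j : ℕ) ≤ i) (a : Fin (n + 2) → S) :
    weight j a * weight i (face j a)
      = weight i.succ a * weight (j.castLT (by omega)) (face i.succ a) := by
  have hc := mul_comm (a 0 : WithOne S) (a (Fin.last (n + 1)))
  have h0 : (0 : Fin (n + 1)).succ = 1 := rfl
  have hl : (Fin.last n).succ = Fin.last (n + 1) := rfl
  simp only [weight, face, Fin.val_succ, Fin.val_zero, Fin.val_last, Fin.val_castLT,
    Fin.castSucc_zero, hl]
  by_cases hj : (j : ℕ) = 0 <;> by_cases hi : (i : ℕ) = 0 <;>
    by_cases hi' : (i : ℕ) = n + 1 <;> by_cases hj' : (j : ℕ) = n + 1 <;>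
    simp_all
  · exact mul_comm _ _
  · split_ifs <;> first | rfl | omega
  all_goals omega

variable [CommSemigroup S] (ρ : S →ₙ* (M →L[ℂ] M))

/-- The coboundary of an `M`-valued function on `Sⁿ`, for the symmetric action `ρ`. -/
def delta (n : ℕ) : ((Fin n → S) → M) →ₗ[ℂ] ((Fin (n + 1) → S) → M) where
  toFun F a := ∑ i : Fin (n + 2), (-1 : ℂ) ^ (i : ℕ) • WithOne.lift ρ (weight i a) (F (face i a))
  map_add' F G := by
    ext a
    simp [Finset.sum_add_distrib]
  map_smul' c F := by
    ext a
    simp [Finset.smul_sum, smul_comm c]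

theorem delta_apply {n : ℕ} (F : (Fin n → S) → M) (a : Fin (n + 1) → S) :
    delta ρ n F a
      = ∑ i : Fin (n + 2), (-1 : ℂ) ^ (i : ℕ) • WithOne.lift ρ (weight i a) (F (face i a)) :=
  rfl

theorem delta_apply_eq {n : ℕ} (F : (Fin n → S) → M) (a : Fin (n + 1) → S) :
    delta ρ n F a = ρ (a 0) (F (Fin.tail a))
      + ∑ j : Fin n, (-1 : ℂ) ^ ((j : ℕ) + 1) • F (Fin.contractNth j.castSucc (· * ·) a)
      + (-1 : ℂ) ^ (n + 1) • ρ (a (Fin.last n)) (F (Fin.init a)) := by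
  rw [delta_apply, Fin.sum_univ_succ, Fin.sum_univ_castSucc, ← add_assoc]
  congr 1
  · congr 1
    · simp [weight, face_zero]
    · refine Finset.sum_congr rfl fun j _ => ?_
      have : (j : ℕ) ≠ n := j.2.ne
      rw [face_succ_castSucc]
      simp [weight, this]
  · rw [Fin.succ_last, face_last]
    simp [weight]

theorem delta_delta {n : ℕ} (F : (Fin n → S) → M) : delta ρ (n + 1) (delta ρ n F) = 0 := by
  ext a
  simp only [delta_apply, map_sum, map_smul, Finset.smul_sum, smul_smul, Pi.zero_apply]
  simp only [← mul_apply_eq_comp, ← map_mul]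
  rw [Finset.sum_comm, ← Finset.sum_product', Finset.univ_product_univ]
  let U : Finset (Fin (n + 2) × Fin (n + 3)) := {ij | (ij.2 : ℕ) ≤ (ij.1 : ℕ)}
  rw [← Finset.sum_add_sum_compl U, ← eq_neg_iff_add_eq_zero, ← Finset.sum_neg_distrib]
  -- Simplicial cancellation: for `j ≤ i`, the term of `(i, j)` cancels that of `(j, i + 1)`.
  refine Finset.sum_bij (fun ij hij =>
    (Fin.castLT ij.2 ((Finset.mem_filter.mp hij).right.trans_lt ij.1.is_lt), ij.1.succ))
    ?_ ?_ ?_ ?_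
  · intro ij hij
    simp only [U, Finset.compl_filter, Finset.mem_filter_univ, Fin.val_succ,
      Fin.val_castLT] at hij ⊢
    omega
  · rintro ⟨i, j⟩ hij ⟨i', j'⟩ hij' h
    simp only [Prod.mk.injEq, Fin.ext_iff, Fin.val_castLT, Fin.val_succ] at h ⊢
    omega
  · rintro ⟨i, j⟩ hij
    simp only [U, Finset.compl_filter, Finset.mem_filter_univ, not_le] at hij
    refine ⟨(j.pred fun h => by simp [h] at hij, i.castSucc), ?_, ?_⟩
    · simpa [U] using Nat.le_sub_one_of_lt hij
    · simp
  · rintro ⟨i, j⟩ hij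
    simp only [U, Finset.mem_filter_univ] at hij
    rw [weight_weight i j hij, face_face i j hij, ← neg_smul]
    congr 1
    simp only [Fin.val_succ, Fin.val_castLT]
    ring

/-! ### The averaging operators -/

/-- The action of `s ⊗ s + (1 - s) ⊗ (1 - s)` on functions on `S` with an identity adjoined. -/
def average (s : S) : (WithOne S → M) →ₗ[ℂ] (WithOne S → M) where
  toFun Φ t := Φ t - Φ (s * t) + ρ s ((2 : ℂ) • Φ (s * t) - Φ t)
  map_add' Φ Ψ := by
    ext t
    simp only [Pi.add_apply, smul_add, map_add, map_sub]
    abel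
  map_smul' c Φ := by
    ext t
    simp only [Pi.smul_apply, map_sub, map_smul, smul_add, smul_sub, RingHom.id_apply,
      smul_comm c]

theorem average_apply (s : S) (Φ : WithOne S → M) (t : WithOne S) :
    average ρ s Φ t = Φ t - Φ (s * t) + ρ s ((2 : ℂ) • Φ (s * t) - Φ t) := rfl

/-- The composition of the averaging operators of the entries of a list. -/
def averageList : List S → ((WithOne S → M) →ₗ[ℂ] (WithOne S → M))
  | [] => LinearMap.id
  | s :: l => average ρ s ∘ₗ averageList l

theorem apply_comm (s t : S) (x : M) : ρ s (ρ t x) = ρ t (ρ s x) := by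
  rw [← mul_apply_eq_comp, ← map_mul, mul_comm, map_mul, mul_apply_eq_comp]

theorem apply_lift (s : S) (t : WithOne S) (x : M) :
    ρ s (WithOne.lift ρ t x) = WithOne.lift ρ (s * t) x := by
  simp

theorem averageList_translate (l : List S) (a : S) (Φ : WithOne S → M) (t : WithOne S) :
    averageList ρ l (fun u => Φ (u * a)) t = averageList ρ l Φ (t * a) := by
  induction l generalizing t with
  | nil => rfl
  | cons s l ih => simp only [averageList, LinearMap.comp_apply, average_apply, ih, mul_assoc]

theorem averageList_smul (l : List S) (a : S) (Φ : WithOne S → M) (t : WithOne S) :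
    averageList ρ l (fun u => ρ a (Φ u)) t = ρ a (averageList ρ l Φ t) := by
  induction l generalizing t with
  | nil => rfl
  | cons s l ih =>
    simp only [averageList, LinearMap.comp_apply, average_apply, ih, map_sub, map_add, map_smul,
      apply_comm ρ s a]

/-- Multiplying out a diagonal gives the unit: `s * s + (1 - s) * (1 - s) = 1` when `s` is
idempotent. -/
theorem averageList_lift (hS : ∀ s : S, IsIdempotentElem s) (l : List S) (x : M) (t : WithOne S) :
    averageList ρ l (fun u => WithOne.lift ρ u x) t = WithOne.lift ρ t x := by
  induction l generalizing t with
  | nil => rfl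
  | cons s l ih =>
    have h : ρ s (ρ s (WithOne.lift ρ t x)) = ρ s (WithOne.lift ρ t x) := by
      rw [← mul_apply_eq_comp, ← map_mul, (hS s).eq]
    simp only [averageList, LinearMap.comp_apply, average_apply, ih, map_sub, map_smul,
      ← apply_lift, h]
    rw [two_smul]
    abel

/-- For an entry `a` of `l`, multiplying its diagonal by `a` in either tensor factor gives `a ⊗ a`,
and the other averages commute with `a`. Products follow because translation and action are both
multiplicative. -/
theorem averageList_translate_of_mem_closure (hS : ∀ s : S, IsIdempotentElem s) {l : List S} {a : S}
    (ha : a ∈ Subsemigroup.closure {s | s ∈ l}) (Φ : WithOne S → M) (t : WithOne S) :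
    averageList ρ l (fun u => Φ (u * a)) t = ρ a (averageList ρ l Φ t) := by
  induction ha using Subsemigroup.closure_induction generalizing Φ t with
  | mem a ha =>
    simp only [Set.mem_ofPred_eq] at ha
    induction l generalizing t with
    | nil => simp at ha
    | cons s l ih =>
      rcases List.mem_cons.1 ha with rfl | h
      · have h2 : ∀ x, ρ a (ρ a x) = ρ a x := fun x => by
          rw [← mul_apply_eq_comp, ← map_mul, (hS a).eq]
        rw [averageList_translate]
        simp only [averageList, LinearMap.comp_apply, average_apply, mul_comm t, map_add,
          map_sub, h2, two_smul, ← mul_assoc, ← WithOne.coe_mul, (hS a).eq]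
        abel
      · simp only [averageList, LinearMap.comp_apply, average_apply, ih h, map_sub, map_add,
          map_smul, apply_comm ρ s a]
  | mul a b _ _ iha ihb =>
    simp only [WithOne.coe_mul, ← mul_assoc, map_mul, mul_apply_eq_comp]
    rw [← ihb]
    exact iha (fun u => Φ (u * b)) t

/-! ### Contraction of the first variable -/

/-- Extend a function on `S` by zero to the adjoined identity, average it over `l`, and evaluate
at the identity. -/
def contract (l : List S) : (S → M) →ₗ[ℂ] M where
  toFun φ := averageList ρ l (WithOne.recOneCoe 0 φ) 1
  map_add' φ ψ := by
    rw [← Pi.add_apply, ← map_add]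
    refine congrArg (averageList ρ l · 1) (funext fun u => ?_)
    cases u <;> simp
  map_smul' c φ := by
    rw [RingHom.id_apply, ← Pi.smul_apply, ← map_smul]
    refine congrArg (averageList ρ l · 1) (funext fun u => ?_)
    cases u <;> simp

theorem contract_apply (l : List S) (φ : S → M) :
    contract ρ l φ = averageList ρ l (WithOne.recOneCoe 0 φ) 1 := rfl

theorem contract_smul (l : List S) (a : S) (φ : S → M) :
    contract ρ l (fun s => ρ a (φ s)) = ρ a (contract ρ l φ) := by
  rw [contract_apply, contract_apply, ← averageList_smul]
  refine congrArg (averageList ρ l · 1) (funext fun u => ?_)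
  cases u <;> simp

theorem contract_sub_translate (hS : ∀ s : S, IsIdempotentElem s) {l : List S} {a : S}
    (ha : a ∈ Subsemigroup.closure {s | s ∈ l}) (φ : S → M) :
    contract ρ l (fun s => ρ s (φ a) - φ (s * a)) = φ a - ρ a (contract ρ l φ) := by
  let Φ : WithOne S → M := WithOne.recOneCoe 0 φ
  -- The default value `0` is the right one: at the adjoined identity both terms on the right equal
  -- `φ a`.
  have h : (WithOne.recOneCoe 0 (fun s => ρ s (φ a) - φ (s * a)) : WithOne S → M)
      = (fun u => WithOne.lift ρ u (φ a)) - fun u => Φ (u * a) := by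
    ext u
    cases u <;> simp [Φ, ← WithOne.coe_mul]
  rw [contract_apply, contract_apply, h, map_sub, Pi.sub_apply, averageList_lift ρ hS,
    averageList_translate_of_mem_closure ρ hS ha]
  simp [Φ]

/-- Contraction of the first variable of a cochain. -/
def contractFirst (l : List S) (n : ℕ) : ((Fin (n + 1) → S) → M) →ₗ[ℂ] ((Fin n → S) → M) where
  toFun F a := contract ρ l fun s => F (Fin.cons s a)
  map_add' F G := by
    ext a
    exact map_add (contract ρ l) (fun s => F (Fin.cons s a)) fun s => G (Fin.cons s a)
  map_smul' c F := by
    ext a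
    exact map_smul (contract ρ l) c fun s => F (Fin.cons s a)

theorem contractFirst_apply (l : List S) {n : ℕ} (F : (Fin (n + 1) → S) → M) (a : Fin n → S) :
    contractFirst ρ l n F a = contract ρ l fun s => F (Fin.cons s a) := rfl

/-- The subtracted bracket is the coboundary of `F (s, ·)` at `a` without its leading term;
`contract_sub_translate` supplies that term after contraction. -/
theorem delta_cons {n : ℕ} (F : (Fin (n + 1) → S) → M) (s : S) (a : Fin (n + 1) → S) :
    delta ρ (n + 1) F (Fin.cons s a) = (ρ s (F a) - F (Fin.cons (s * a 0) (Fin.tail a)))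
      - (∑ j : Fin n, (-1 : ℂ) ^ ((j : ℕ) + 1) •
          F (Fin.cons s (Fin.contractNth j.castSucc (· * ·) a))
        + (-1 : ℂ) ^ (n + 1) • ρ (a (Fin.last n)) (F (Fin.cons s (Fin.init a)))) := by
  have h0 : Fin.contractNth (0 : Fin (n + 1)).castSucc (· * ·) (Fin.cons s a : Fin (n + 2) → S)
      = Fin.cons (s * a 0) (Fin.tail a) := by
    ext k
    cases k using Fin.cases <;> simp [Fin.contractNth, Fin.tail]
  have h1 : ∀ j : Fin n, Fin.contractNth j.succ.castSucc (· * ·) (Fin.cons s a : Fin (n + 2) → S)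
      = Fin.cons s (Fin.contractNth j.castSucc (· * ·) a) := by
    intro j
    ext k
    cases k using Fin.cases <;> simp [Fin.contractNth]
  have h2 : Fin.init (Fin.cons s a : Fin (n + 2) → S) = Fin.cons s (Fin.init a) := by
    ext k
    cases k using Fin.cases <;> simp [Fin.init]
  have hl : (Fin.cons s a : Fin (n + 2) → S) (Fin.last (n + 1)) = a (Fin.last n) := rfl
  rw [delta_apply_eq, Fin.sum_univ_succ, h0, h2, hl]
  simp only [h1, Fin.cons_zero, Fin.tail_cons, Fin.val_succ, Fin.val_zero, pow_succ _ (_ + 1),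
    mul_neg_one, neg_smul, Finset.sum_neg_distrib, zero_add, pow_one, one_smul]
  abel

theorem contractFirst_delta (hS : ∀ s : S, IsIdempotentElem s) {l : List S} {n : ℕ}
    (F : (Fin (n + 1) → S) → M) {a : Fin (n + 1) → S}
    (ha : a 0 ∈ Subsemigroup.closure {s | s ∈ l}) :
    contractFirst ρ l (n + 1) (delta ρ (n + 1) F) a = F a - delta ρ n (contractFirst ρ l n F) a := by
  have h1 := contract_sub_translate ρ hS ha fun s => F (Fin.cons s (Fin.tail a))
  simp only [Fin.cons_self_tail] at h1
  have h2 : (fun s => delta ρ (n + 1) F (Fin.cons s a))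
      = (fun s => ρ s (F a) - F (Fin.cons (s * a 0) (Fin.tail a)))
        - (∑ j : Fin n, (-1 : ℂ) ^ ((j : ℕ) + 1) •
            (fun s => F (Fin.cons s (Fin.contractNth j.castSucc (· * ·) a)))
          + (-1 : ℂ) ^ (n + 1) • fun s => ρ (a (Fin.last n)) (F (Fin.cons s (Fin.init a)))) := by
    ext s
    simp [delta_cons]
  rw [contractFirst_apply, h2, map_sub, h1, map_add, map_sum, delta_apply_eq]
  simp only [map_smul, contract_smul, contractFirst_apply]
  abel

/-! ### The homotopy -/

/-- A contracting homotopy of the complex of cochains in positive degrees. -/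
def homotopy : (n : ℕ) → ((Fin (n + 1) → S) → M) →ₗ[ℂ] ((Fin n → S) → M)
  | 0 => 0
  | n + 1 =>
    { toFun := fun F s =>
        -- The list varies with the point of evaluation, but within the correction term `s` stays
        -- fixed while `delta` evaluates at the faces of `s`.
        (contractFirst ρ (List.ofFn s) (n + 1) F
          - delta ρ n (homotopy n (contractFirst ρ (List.ofFn s) (n + 1) F))) s
      map_add' := fun F G => by
        ext s
        simp only [map_add, Pi.sub_apply, Pi.add_apply]
        abel
      map_smul' := fun c F => by
        ext s
        simp only [map_smul, Pi.sub_apply, Pi.smul_apply, smul_sub, RingHom.id_apply] }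

theorem homotopy_succ_apply {n : ℕ} (F : (Fin (n + 2) → S) → M) (s : Fin (n + 1) → S) :
    homotopy ρ (n + 1) F s = contractFirst ρ (List.ofFn s) (n + 1) F s
      - delta ρ n (homotopy ρ n (contractFirst ρ (List.ofFn s) (n + 1) F)) s := rfl

/-! ### Locality: restriction to a subsemigroup. -/

section Local

variable (T : Subsemigroup S)

theorem contract_eq_zero {l : List S} (hl : ∀ s ∈ l, s ∈ T) {φ : S → M}
    (hφ : ∀ s ∈ T, φ s = 0) : contract ρ l φ = 0 := by
  let Z : (WithOne S → M) → Prop := fun Φ => Φ 1 = 0 ∧ ∀ s ∈ T, Φ (s : WithOne S) = 0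
  have key : ∀ Φ, Z Φ → Z (averageList ρ l Φ) := by
    induction l with
    | nil => exact fun Φ h => h
    | cons s l ih =>
      intro Φ h
      have hs := hl s (by simp)
      obtain ⟨h1, h2⟩ := ih (fun t ht => hl t (by simp [ht])) Φ h
      refine ⟨?_, fun t ht => ?_⟩
      · simp [averageList, average_apply, h1, h2 s hs]
      · simp [averageList, average_apply, ← WithOne.coe_mul, h2 t ht, h2 _ (T.mul_mem hs ht)]
  exact (key _ ⟨rfl, hφ⟩).1

theorem contractFirst_eq_zero {l : List S} (hl : ∀ s ∈ l, s ∈ T) {n : ℕ}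
    {F : (Fin (n + 1) → S) → M} (hF : ∀ a, (∀ i, a i ∈ T) → F a = 0) {a : Fin n → S}
    (ha : ∀ i, a i ∈ T) : contractFirst ρ l n F a = 0 :=
  contract_eq_zero ρ T hl fun s hs => hF _ fun i => by cases i using Fin.cases <;> simp [hs, ha]

theorem delta_eq_zero {n : ℕ} {F : (Fin n → S) → M} (hF : ∀ a, (∀ i, a i ∈ T) → F a = 0)
    {a : Fin (n + 1) → S} (ha : ∀ i, a i ∈ T) : delta ρ n F a = 0 := by
  rw [delta_apply]
  refine Finset.sum_eq_zero fun i _ => ?_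
  rw [hF, map_zero, smul_zero]
  intro k
  unfold face
  split_ifs
  exacts [ha _, T.mul_mem (ha _) (ha _), ha _]

theorem homotopy_eq_zero {n : ℕ} {F : (Fin (n + 1) → S) → M}
    (hF : ∀ a, (∀ i, a i ∈ T) → F a = 0) {a : Fin n → S} (ha : ∀ i, a i ∈ T) :
    homotopy ρ n F a = 0 := by
  induction n with
  | zero => rfl
  | succ n ih =>
    have hl : ∀ s ∈ List.ofFn a, s ∈ T := by
      intro s hs
      obtain ⟨i, rfl⟩ := (List.mem_ofFn' _ _).1 hs
      exact ha i
    have hK := fun b hb => contractFirst_eq_zero ρ T hl hF (a := b) hb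
    rw [homotopy_succ_apply, hK a ha, delta_eq_zero ρ T (fun b hb => ih hK hb) ha, sub_zero]

end Local

/-- Symmetry of the action makes the two outer terms cancel; this starts the induction in
`homotopy_delta`. -/
theorem delta_zero (F : (Fin 0 → S) → M) : delta ρ 0 F = 0 := by
  ext a
  rw [delta_apply_eq, Subsingleton.elim (Fin.tail a) (Fin.init a)]
  simp

theorem homotopy_delta (hS : ∀ s : S, IsIdempotentElem s) {n : ℕ} (F : (Fin (n + 1) → S) → M) :
    homotopy ρ (n + 1) (delta ρ (n + 1) F) = F - delta ρ n (homotopy ρ n F) := by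
  induction n with
  | zero =>
    ext s
    rw [homotopy_succ_apply, contractFirst_delta ρ hS _
      (Subsemigroup.subset_closure ((List.mem_ofFn' _ _).2 ⟨0, rfl⟩))]
    simp [delta_zero]
  | succ n ih =>
    ext s
    let T := Subsemigroup.closure {t | t ∈ List.ofFn s}
    let G := contractFirst ρ (List.ofFn s) (n + 1) F
    have hs : ∀ i, s i ∈ T := fun i =>
      Subsemigroup.subset_closure ((List.mem_ofFn' _ _).2 ⟨i, rfl⟩)
    -- The contraction identity is available only on tuples from `T`, which suffices by locality.
    have hK : ∀ a, (∀ i, a i ∈ T) → (contractFirst ρ (List.ofFn s) (n + 2) (delta ρ (n + 2) F)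
        - (F - delta ρ (n + 1) G)) a = 0 := fun a ha => by
      rw [Pi.sub_apply, contractFirst_delta ρ hS F (ha 0), Pi.sub_apply, sub_self]
    have h2 := delta_eq_zero ρ T (F := homotopy ρ (n + 1) _)
      (fun b hb => homotopy_eq_zero ρ T hK hb) hs
    have h1 := hK s hs
    -- By induction `H δ G = G - δ H G`, and `δ` kills the last term, so the correction contributes
    -- `δ H F - δ G`; its `δ G` cancels the one in `h1`.
    simp only [map_sub, ih, delta_delta, Pi.sub_apply, sub_zero] at h1 h2
    rw [homotopy_succ_apply, sub_eq_zero.1 h1, sub_eq_zero.1 h2, Pi.sub_apply]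
    abel

/-! ### Bounds -/

section Bound

variable {C : ℝ}

theorem norm_lift_apply_le (hC : 1 ≤ C) (hρ : ∀ s x, ‖ρ s x‖ ≤ C * ‖x‖) (u : WithOne S) (x : M) :
    ‖WithOne.lift ρ u x‖ ≤ C * ‖x‖ := by
  cases u with
  | one => simpa using le_mul_of_one_le_left (norm_nonneg x) hC
  | coe s => exact hρ s x

/-- The bound sees `l` only through its length, hence is uniform over all tuples of a fixed size. -/
theorem norm_averageList_le (hC : 1 ≤ C) (hρ : ∀ s x, ‖ρ s x‖ ≤ C * ‖x‖) (l : List S)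
    {Φ : WithOne S → M} {B : ℝ} (hΦ : ∀ u, ‖Φ u‖ ≤ B) (t : WithOne S) :
    ‖averageList ρ l Φ t‖ ≤ (2 + 3 * C) ^ l.length * B := by
  induction l generalizing t with
  | nil => simpa [averageList] using hΦ t
  | cons s l ih =>
    set Ψ := averageList ρ l Φ
    set D := (2 + 3 * C) ^ l.length * B
    calc ‖averageList ρ (s :: l) Φ t‖
        = ‖Ψ t - Ψ (s * t) + ρ s ((2 : ℂ) • Ψ (s * t) - Ψ t)‖ := rfl
      _ ≤ ‖Ψ t - Ψ (s * t)‖ + ‖ρ s ((2 : ℂ) • Ψ (s * t) - Ψ t)‖ := norm_add_le _ _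
      _ ≤ (D + D) + C * (2 * D + D) := by
        refine add_le_add ((norm_sub_le _ _).trans (add_le_add (ih _) (ih _)))
          ((hρ _ _).trans (mul_le_mul_of_nonneg_left ?_ (by linarith)))
        refine (norm_sub_le _ _).trans (add_le_add ?_ (ih _))
        rw [norm_smul]
        simpa using ih (s * t)
      _ = (2 + 3 * C) ^ (s :: l).length * B := by
        rw [List.length_cons, pow_succ', mul_assoc]
        ring

theorem norm_contractFirst_le (hC : 1 ≤ C) (hρ : ∀ s x, ‖ρ s x‖ ≤ C * ‖x‖) (l : List S) {n : ℕ}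
    {F : (Fin (n + 1) → S) → M} {B : ℝ} (hF : ∀ a, ‖F a‖ ≤ B) (a : Fin n → S) :
    ‖contractFirst ρ l n F a‖ ≤ (2 + 3 * C) ^ l.length * max B 0 := by
  refine norm_averageList_le ρ hC hρ l (fun u => ?_) 1
  cases u with
  -- The value `0` at the adjoined identity must be covered too, hence `max B 0`.
  | one => simp
  | coe s => exact (hF _).trans (le_max_left _ _)

theorem norm_delta_le (hC : 1 ≤ C) (hρ : ∀ s x, ‖ρ s x‖ ≤ C * ‖x‖) {n : ℕ}
    {F : (Fin n → S) → M} {B : ℝ} (hF : ∀ a, ‖F a‖ ≤ B) (a : Fin (n + 1) → S) :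
    ‖delta ρ n F a‖ ≤ (n + 2) * (C * B) := by
  calc ‖delta ρ n F a‖ ≤ ∑ _i : Fin (n + 2), C * B := by
        rw [delta_apply]
        refine norm_sum_le_of_le _ fun i _ => ?_
        rw [norm_smul, norm_pow, norm_neg, norm_one, one_pow, one_mul]
        exact (norm_lift_apply_le ρ hC hρ _ _).trans
          (mul_le_mul_of_nonneg_left (hF _) (by linarith))
    _ = (n + 2) * (C * B) := by simp

theorem exists_norm_homotopy_le (hC : 1 ≤ C) (hρ : ∀ s x, ‖ρ s x‖ ≤ C * ‖x‖) (n : ℕ) (B : ℝ) :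
    ∃ D : ℝ, ∀ F : (Fin (n + 1) → S) → M, (∀ a, ‖F a‖ ≤ B) → ∀ s, ‖homotopy ρ n F s‖ ≤ D := by
  induction n generalizing B with
  | zero => exact ⟨0, fun F _ s => by simp [homotopy]⟩
  | succ n ih =>
    set B' := (2 + 3 * C) ^ (n + 1) * max B 0 with hB'
    obtain ⟨D, hD⟩ := ih B'
    refine ⟨B' + (n + 2) * (C * D), fun F hF s => ?_⟩
    have hK : ∀ a, ‖contractFirst ρ (List.ofFn s) (n + 1) F a‖ ≤ B' := fun a => by
      simpa using norm_contractFirst_le ρ hC hρ (List.ofFn s) hF a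
    rw [homotopy_succ_apply]
    exact (norm_sub_le _ _).trans
      (add_le_add (hK s) (norm_delta_le ρ hC hρ (hD _ hK) s))

end Bound

end SemigroupCochain

/-! ### Bounded multilinear maps on `ℓ¹(S)` as bounded functions on tuples. -/

namespace EllOne

variable {S : Type*}

open Classical in
/-- The point mass at `s`. -/
def pointMass (s : S) : EllOne S := lp.single 1 s (1 : ℂ)

theorem norm_pointMass (s : S) : ‖pointMass s‖ = 1 := by
  simp [pointMass, lp.norm_single]

open Classical in
theorem pointMass_apply (s t : S) : pointMass s t = if t = s then 1 else 0 := by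
  simp [pointMass, Pi.single_apply]

theorem pointMass_mul [Semigroup S] (s t : S) :
    pointMass s * pointMass t = pointMass (s * t) := by
  classical
  ext u
  rw [mul_apply, pointMass_apply]
  split_ifs with h
  · subst h
    rw [tsum_eq_single ⟨(s, t), rfl⟩]
    · simp [pointMass_apply]
    · rintro ⟨⟨x, y⟩, hxy⟩ hne
      simp only [pointMass_apply, ne_eq, Subtype.mk.injEq, Prod.mk.injEq] at hne ⊢
      grind
  · refine (tsum_congr fun p => ?_).trans tsum_zero
    obtain ⟨⟨x, y⟩, hxy⟩ := p
    simp only [pointMass_apply]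
    grind

variable {E : Type*} [NormedAddCommGroup E] [NormedSpace ℂ E]

theorem clm_ext {f g : EllOne S →L[ℂ] E} (h : ∀ s, f (pointMass s) = g (pointMass s)) :
    f = g := by
  classical
  refine lp.ext_continuousLinearMap (by simp) fun s => ?_
  ext
  exact h s

theorem multilinear_ext {n : ℕ} {F G : ContinuousMultilinearMap ℂ (fun _ : Fin n => EllOne S) E}
    (h : ∀ s : Fin n → S, F (fun i => pointMass (s i)) = G (fun i => pointMass (s i))) :
    F = G := by
  induction n with
  | zero =>
    ext a
    rw [Subsingleton.elim a fun i => pointMass (i.elim0)]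
    exact h _
  | succ n ih =>
    rw [← F.uncurry_curryLeft, ← G.uncurry_curryLeft]
    congr 1
    refine clm_ext fun s => ih fun t => ?_
    have hc : (Fin.cons (pointMass s) fun i => pointMass (t i) : Fin (n + 1) → EllOne S)
        = fun i => pointMass ((Fin.cons s t : Fin (n + 1) → S) i) := by
      ext1 i
      cases i using Fin.cases <;> rfl
    rw [ContinuousMultilinearMap.curryLeft_apply, ContinuousMultilinearMap.curryLeft_apply, hc]
    exact h _

variable [CompleteSpace E]

theorem summable_smul {g : S → E} {B : ℝ} (hg : ∀ s, ‖g s‖ ≤ B) (f : EllOne S) :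
    Summable fun s => f s • g s :=
  Summable.of_norm_bounded ((summable_norm f).mul_right B) fun s => by
    rw [norm_smul]
    exact mul_le_mul_of_nonneg_left (hg s) (norm_nonneg _)

/-- The universal property of `ℓ¹(S)`. The norm control lets `exists_multilinear` iterate it by
currying. -/
theorem exists_clm {g : S → E} {B : ℝ} (hB : 0 ≤ B) (hg : ∀ s, ‖g s‖ ≤ B) :
    ∃ f : EllOne S →L[ℂ] E, ‖f‖ ≤ B ∧ ∀ s, f (pointMass s) = g s := by
  let f : EllOne S →ₗ[ℂ] E :=
    { toFun := fun a => ∑' s, a s • g s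
      map_add' := fun a b => by
        rw [← (summable_smul hg a).tsum_add (summable_smul hg b)]
        simp [add_smul]
      map_smul' := fun c a => by
        simp [mul_smul, (summable_smul hg a).tsum_const_smul] }
  refine ⟨f.mkContinuous B fun a => ?_, LinearMap.mkContinuous_norm_le _ hB _, fun s => ?_⟩
  · rw [norm_eq_tsum, mul_comm, ← tsum_mul_right]
    refine tsum_of_norm_bounded ((summable_norm a).mul_right B).hasSum fun s => ?_
    rw [norm_smul]
    exact mul_le_mul_of_nonneg_left (hg s) (norm_nonneg _)
  · change ∑' t, pointMass s t • g t = g s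
    rw [tsum_eq_single s]
    · simp [pointMass_apply]
    · intro t ht
      simp [pointMass_apply, ht]

theorem exists_multilinear {n : ℕ} {g : (Fin n → S) → E} {B : ℝ} (hB : 0 ≤ B)
    (hg : ∀ s, ‖g s‖ ≤ B) :
    ∃ F : ContinuousMultilinearMap ℂ (fun _ : Fin n => EllOne S) E,
      ‖F‖ ≤ B ∧ ∀ s : Fin n → S, F (fun i => pointMass (s i)) = g s := by
  induction n with
  | zero =>
    refine ⟨ContinuousMultilinearMap.constOfIsEmpty ℂ _ (g Fin.elim0), ?_, fun s => ?_⟩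
    · simpa using hg _
    · simp [Subsingleton.elim s Fin.elim0]
  | succ n ih =>
    choose F hF hFg using fun s : S => ih (g := fun t => g (Fin.cons s t)) fun t => hg _
    obtain ⟨f, hf, hfF⟩ := exists_clm hB hF
    refine ⟨f.uncurryLeft, by rwa [ContinuousLinearMap.uncurryLeft_norm], fun s => ?_⟩
    rw [ContinuousLinearMap.uncurryLeft_apply, hfF]
    exact (hFg _ _).trans (congrArg g (Fin.cons_self_tail s))

end EllOne

/-! ### Comparison of the Hochschild coboundary with `delta`. -/

namespace BanachBimodule

variable {S M : Type*} [NormedAddCommGroup M] [NormedSpace ℂ M]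

/-- The action of the point masses on the left of a bimodule over `ℓ¹(S)`. -/
def pointAction [Semigroup S] (X : BanachBimodule (EllOne S) M) : S →ₙ* (M →L[ℂ] M) where
  toFun s := X.left (EllOne.pointMass s)
  map_mul' s t := by
    ext x
    simp [← EllOne.pointMass_mul, X.left_mul]

open SemigroupCochain EllOne in
theorem coboundary_pointMass [CommSemigroup S] (X : BanachBimodule (EllOne S) M)
    (hX : X.IsSymmetric) {n : ℕ} (F : HochschildCochain (EllOne S) M n) (s : Fin (n + 1) → S) :
    Hochschild.coboundary X n F (fun i => pointMass (s i))
      = delta X.pointAction n (fun t => F fun i => pointMass (t i)) s := by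
  rw [Hochschild.coboundary_apply, delta_apply_eq, ← hX]
  have h : ∀ j : Fin n, Fin.contractNth j.castSucc (· * ·) (fun i => pointMass (s i))
      = fun i => pointMass (Fin.contractNth j.castSucc (· * ·) s i) := fun j =>
    (Fin.comp_contractNth _ _ (fun x y => (pointMass_mul x y).symm) j.castSucc s).symm
  simp only [h]
  rfl

end BanachBimodule

end

open SemigroupCochain EllOne in
theorem corollary4p3 {S : Type*} [CommSemigroup S] (hS : ∀ s : S, IsIdempotentElem s)
    {M : Type*} [NormedAddCommGroup M] [NormedSpace ℂ M] [CompleteSpace M]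
    (X : BanachBimodule (EllOne S) M) (hX : X.IsSymmetric) (n : ℕ) (hn : 1 ≤ n) :
    Subsingleton (Hochschild.Cohomology X n) := by
  obtain ⟨n, rfl⟩ := Nat.exists_eq_add_of_le' hn
  rw [Submodule.Quotient.subsingleton_iff, Submodule.submoduleOf_eq_top]
  intro F hF
  let ρ := X.pointAction
  let F₀ : (Fin (n + 1) → S) → M := fun t => F fun i => pointMass (t i)
  -- The constant is at least `1` because the adjoined identity also acts.
  have hρ : ∀ s x, ‖ρ s x‖ ≤ max 1 ‖X.left‖ * ‖x‖ := fun s x => by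
    have := X.left.le_opNorm (pointMass s)
    rw [norm_pointMass, mul_one] at this
    exact ((X.left _).le_of_opNorm_le this x).trans
      (mul_le_mul_of_nonneg_right (le_max_right _ _) (norm_nonneg _))
  have hb : ∀ t, ‖F₀ t‖ ≤ ‖F‖ := fun t => by
    simpa [norm_pointMass] using F.le_opNorm fun i => pointMass (t i)
  obtain ⟨D, hD⟩ := exists_norm_homotopy_le ρ (le_max_left _ _) hρ n ‖F‖
  -- The homotopy applied to `F₀` is bounded, so it extends to a cochain `G`; since `δ F₀ = 0`, the
  -- identity `H δ + δ H = 1` makes `G` a primitive of `F`.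
  obtain ⟨G, -, hG⟩ := exists_multilinear (le_max_right D 0)
    fun s => (hD F₀ hb s).trans (le_max_left D 0)
  refine ⟨G, multilinear_ext fun s => ?_⟩
  have hδ : delta ρ (n + 1) F₀ = 0 := by
    ext s
    rw [← X.coboundary_pointMass hX, LinearMap.mem_ker.1 hF]
    rfl
  have h := homotopy_delta ρ hS F₀
  rw [hδ, map_zero, eq_comm, sub_eq_zero] at h
  rw [X.coboundary_pointMass hX, funext hG]
  exact (congrFun h s).symm
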